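/- For $U\in SU(2)$ write $U=\sum_{j}e^{-id_j}|j\rangle\langle j|$ with an orthonormal basis of eigenvectors $|j\rangle$ and $d_j\in(-\pi,\pi]$, and put $H_U=\sum_j d_j|j\rangle\langle j|$ (this matrix does not depend on the choice of eigenbasis). Let $dU$ be the Haar measure on $SU(2)$ normalized by $\int_{SU(2)}dU=1$, let $\sigma_z=\begin{pmatrix}1&0\\0&-1\end{pmatrix}$, and let $\rho(0)=\tfrac12(I+\sigma_z)$. For $t\in\mathbb R$ define $$\rho(t)=\int_{SU(2)}e^{-iH_Ut}\,\rho(0)\,e^{iH_Ut}\,dU .$$ Then the integral converges absolutely for every $t\in\mathbb R$, and $$\rho(t)=\tfrac12\bigl(I+n_z(t)\sigma_z\bigr),$$ where $n_z:\mathbb R\to\mathbb R$ is continuous and $$n_z(t)=\frac13+\frac{\sin(2\pi t)}{3\pi(t-t^3)}\qquad\text{for all } t\notin\{0,1,-1\}.$$ At the removable singularities $t=0$ and $t=1$ of this formula one has $n_z(0)=1$ and $n_z(1)=0$. -/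

import Mathlib

open MeasureTheory

/-- The special unitary group `SU(N)`. -/
abbrev SU (N : ℕ) : Submonoid (Matrix (Fin N) (Fin N) ℂ) :=
  Matrix.specialUnitaryGroup (Fin N) ℂ

instance instIsTopologicalGroupSU (N : ℕ) : IsTopologicalGroup (SU N) where
  continuous_mul := by fun_prop
  continuous_inv :=
    Continuous.subtype_mk (continuous_star.comp continuous_subtype_val) _

theorem isCompact_SU (N : ℕ) : IsCompact (SU N : Set (Matrix (Fin N) (Fin N) ℂ)) := by
  have hball : IsCompact
      (Set.univ.pi fun _ : Fin N => Set.univ.pi fun _ : Fin N => Metric.closedBall (0 : ℂ) 1) :=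
    isCompact_univ_pi fun _ => isCompact_univ_pi fun _ => isCompact_closedBall _ _
  refine IsCompact.of_isClosed_subset hball ?_ ?_
  · have : (SU N : Set (Matrix (Fin N) (Fin N) ℂ)) =
        {A | A * star A = 1} ∩ {A | A.det = 1} := by
      ext A
      simp [Matrix.mem_specialUnitaryGroup_iff, Matrix.mem_unitaryGroup_iff]
    rw [this]
    exact (isClosed_eq (by fun_prop) continuous_const).inter
      (isClosed_eq (Continuous.matrix_det continuous_id) continuous_const)
  · intro A hA i _ j _
    have hA' : A ∈ Matrix.unitaryGroup (Fin N) ℂ := (Matrix.mem_specialUnitaryGroup_iff.mp hA).1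
    simpa using entry_norm_bound_of_unitary hA' i j

instance instCompactSpaceSU (N : ℕ) : CompactSpace (SU N) :=
  isCompact_iff_compactSpace.mp (isCompact_SU N)

noncomputable instance instMeasurableSpaceSU (N : ℕ) : MeasurableSpace (SU N) := borel _

instance instBorelSpaceSU (N : ℕ) : BorelSpace (SU N) := ⟨rfl⟩

/-- The Haar measure on `SU(N)`, normalized to total mass one. -/
noncomputable def haarSU (N : ℕ) : Measure (SU N) := Measure.haarMeasure ⊤

instance instIsProbabilityMeasureHaarSU (N : ℕ) : IsProbabilityMeasure (haarSU N) :=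
  ⟨Measure.haarMeasure_self⟩

/-- `H = ∑ⱼ dⱼ |j⟩⟨j|`, where `U = ∑ⱼ exp(-i dⱼ) |j⟩⟨j|` is an expansion of `U` in an orthonormal
basis of eigenvectors, with all `dⱼ ∈ (-π, π]`. The vectors `|j⟩` are the columns of the unitary
matrix `V`. -/
def IsPrincipalHamiltonian {N : ℕ} (U H : Matrix (Fin N) (Fin N) ℂ) : Prop :=
  ∃ V ∈ Matrix.unitaryGroup (Fin N) ℂ, ∃ d : Fin N → ℝ,
    (∀ j, d j ∈ Set.Ioc (-Real.pi) Real.pi) ∧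
    U = V * Matrix.diagonal (fun j => Complex.exp (-(Complex.I * (d j : ℂ)))) * star V ∧
    H = V * Matrix.diagonal (fun j => (d j : ℂ)) * star V

theorem IsPrincipalHamiltonian.unique {N : ℕ} {U H H' : Matrix (Fin N) (Fin N) ℂ}
    (h : IsPrincipalHamiltonian U H) (h' : IsPrincipalHamiltonian U H') : H = H' := by
  obtain ⟨V, hV, d, hd, hU, rfl⟩ := h
  obtain ⟨V', hV', d', hd', hU', rfl⟩ := h'
  have e1 : star V * V = 1 := Matrix.mem_unitaryGroup_iff'.mp hV
  have e2 : V * star V = 1 := Matrix.mem_unitaryGroup_iff.mp hV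
  have e1' : star V' * V' = 1 := Matrix.mem_unitaryGroup_iff'.mp hV'
  have e2' : V' * star V' = 1 := Matrix.mem_unitaryGroup_iff.mp hV'
  set E := Matrix.diagonal (fun j => Complex.exp (-(Complex.I * (d j : ℂ)))) with hE
  set E' := Matrix.diagonal (fun j => Complex.exp (-(Complex.I * (d' j : ℂ)))) with hE'
  set D := Matrix.diagonal (fun j => (d j : ℂ)) with hD
  set D' := Matrix.diagonal (fun j => (d' j : ℂ)) with hD'
  have key : (star V' * V) * E = E' * (star V' * V) := by
    calc (star V' * V) * E = star V' * (V * E * star V) * V := by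
          simp only [mul_assoc, e1, mul_one]
      _ = star V' * (V' * E' * star V') * V := by rw [← hU, hU']
      _ = (star V' * V') * E' * (star V' * V) := by simp only [mul_assoc]
      _ = E' * (star V' * V) := by rw [e1', one_mul]
  have key2 : (star V' * V) * D = D' * (star V' * V) := by
    ext i j
    have hij := congrFun (congrFun key i) j
    rw [hE, hE', Matrix.mul_diagonal, Matrix.diagonal_mul] at hij
    rw [hD, hD', Matrix.mul_diagonal, Matrix.diagonal_mul]
    by_cases h0 : (star V' * V) i j = 0
    · simp [h0]
    · rw [mul_comm] at hij
      have hexp := mul_right_cancel₀ h0 hij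
      rw [Complex.exp_neg, Complex.exp_neg, inv_inj] at hexp
      have := Complex.exp_inj_of_neg_pi_lt_of_le_pi (x := Complex.I * (d j : ℂ))
        (y := Complex.I * (d' i : ℂ)) (by simpa using (hd j).1) (by simpa using (hd j).2)
        (by simpa using (hd' i).1) (by simpa using (hd' i).2) hexp
      rw [mul_left_cancel₀ Complex.I_ne_zero this, mul_comm]
  calc V * D * star V = (V' * star V') * V * D * star V := by rw [e2', one_mul]
    _ = V' * ((star V' * V) * D) * star V := by simp only [mul_assoc]
    _ = V' * D' * star V' * (V * star V) := by rw [key2]; simp only [mul_assoc]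
    _ = V' * D' * star V' := by rw [e2, mul_one]

open scoped Matrix.Norms.L2Operator in
theorem exists_isPrincipalHamiltonian {N : ℕ} {U : Matrix (Fin N) (Fin N) ℂ}
    (hU : U ∈ Matrix.unitaryGroup (Fin N) ℂ) : ∃ H, IsPrincipalHamiltonian U H := by
  have hnorm : IsStarNormal U := ⟨by
    rw [Commute, SemiconjBy, Matrix.mem_unitaryGroup_iff'.mp hU, Matrix.mem_unitaryGroup_iff.mp hU]⟩
  have hfin : (spectrum ℂ U).Finite := Matrix.finite_spectrum U
  let f : ℂ → ℂ := fun z => (Complex.arg (star z) : ℂ)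
  have hf : ContinuousOn f (spectrum ℂ U) := hfin.continuousOn f
  have hsa : star (cfc f U) = cfc f U := by
    rw [← cfc_star]
    congr 1
    funext z
    simp [f]
  have hH : (cfc f U).IsHermitian := hsa
  have hsp : spectrum ℂ (cfc f U) = f '' spectrum ℂ U := cfc_map_spectrum f U
  have hUexp : U = NormedSpace.exp ((-Complex.I) • cfc f U) := by
    rw [← cfc_const_mul (-Complex.I) f U, ← CFC.exp_eq_normedSpace_exp (𝕜 := ℂ),
      ← cfc_comp' (fun z => NormedSpace.exp z) (fun z => -Complex.I * f z) U]
    nth_rewrite 1 [← cfc_id ℂ U]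
    refine cfc_congr fun z hz => ?_
    have hz1 : ‖z‖ = 1 := by
      have := spectrum.subset_circle_of_unitary hU hz
      simpa using this
    have hs := Complex.norm_mul_exp_arg_mul_I (star z)
    rw [norm_star, hz1, Complex.ofReal_one, one_mul] at hs
    have h2 := congrArg star hs
    rw [star_star] at h2
    simp only [Complex.star_def, ← Complex.exp_conj, map_mul, Complex.conj_ofReal,
      Complex.conj_I] at h2
    rw [id, ← Complex.exp_eq_exp_ℂ, mul_comm]
    exact h2.symm
  refine ⟨cfc f U, hH.eigenvectorUnitary, hH.eigenvectorUnitary.2, hH.eigenvalues, ?_, ?_, ?_⟩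
  · intro j
    have hj : ((hH.eigenvalues j : ℝ) : ℂ) ∈ spectrum ℂ (cfc f U) := by
      have := hH.eigenvalues_mem_spectrum_real j
      exact spectrum.algebraMap_mem ℂ this
    rw [hsp] at hj
    obtain ⟨z, -, hz⟩ := hj
    rw [← Complex.ofReal_injective hz]
    exact Complex.arg_mem_Ioc _
  · have hs := hH.spectral_theorem
    rw [Unitary.conjStarAlgAut_apply] at hs
    have hV := hH.eigenvectorUnitary.2
    have e1 : star (hH.eigenvectorUnitary : Matrix (Fin N) (Fin N) ℂ) * hH.eigenvectorUnitary = 1 :=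
      Matrix.mem_unitaryGroup_iff'.mp hV
    have hinv : star (hH.eigenvectorUnitary : Matrix (Fin N) (Fin N) ℂ) =
        (hH.eigenvectorUnitary : Matrix (Fin N) (Fin N) ℂ)⁻¹ :=
      (Matrix.inv_eq_left_inv e1).symm
    have hunit : IsUnit (hH.eigenvectorUnitary : Matrix (Fin N) (Fin N) ℂ) :=
      (Matrix.isUnit_iff_isUnit_det _).mpr (Matrix.isUnit_det_of_left_inverse e1)
    have hexp : Matrix.diagonal (fun j => Complex.exp (-(Complex.I * (hH.eigenvalues j : ℂ)))) =
        NormedSpace.exp ((-Complex.I) • Matrix.diagonal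
          ((RCLike.ofReal : ℝ → ℂ) ∘ hH.eigenvalues)) := by
      rw [← Matrix.diagonal_smul, Matrix.exp_diagonal]
      congr 1
      funext j
      rw [Pi.coe_exp, ← Complex.exp_eq_exp_ℂ]
      simp
    rw [hexp, hinv, ← Matrix.exp_conj _ _ hunit, ← hinv, mul_smul_comm, smul_mul_assoc, ← hs]
    exact hUexp
  · have hs := hH.spectral_theorem
    rw [Unitary.conjStarAlgAut_apply] at hs
    exact hs

/-- The Hamiltonian `H_U` of `U ∈ SU(N)`, with spectrum in `(-π, π]` and `U = exp(-i H_U)`. -/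
noncomputable def hamiltonianSU {N : ℕ} (U : SU N) : Matrix (Fin N) (Fin N) ℂ :=
  (exists_isPrincipalHamiltonian (Matrix.specialUnitaryGroup_le_unitaryGroup U.2)).choose

theorem hamiltonianSU_spec {N : ℕ} (U : SU N) :
    IsPrincipalHamiltonian (U : Matrix (Fin N) (Fin N) ℂ) (hamiltonianSU U) :=
  (exists_isPrincipalHamiltonian (Matrix.specialUnitaryGroup_le_unitaryGroup U.2)).choose_spec

/-- `exp(-i H_U t) ρ exp(i H_U t)`: the evolution of `ρ` for the fixed noise history `U`. -/
noncomputable def historyEvolution {N : ℕ} (ρ : Matrix (Fin N) (Fin N) ℂ) (t : ℝ) (U : SU N) :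
    Matrix (Fin N) (Fin N) ℂ :=
  NormedSpace.exp ((-(Complex.I * (t : ℂ))) • hamiltonianSU U) * ρ *
    NormedSpace.exp ((Complex.I * (t : ℂ)) • hamiltonianSU U)

/-- `ρ(t) = ∫ exp(-i H_U t) ρ exp(i H_U t) dU` over `SU(N)` with respect to the normalized Haar
measure, the matrix-valued integral being taken entrywise. -/
noncomputable def haarEvolution {N : ℕ} (ρ : Matrix (Fin N) (Fin N) ℂ) (t : ℝ) :
    Matrix (Fin N) (Fin N) ℂ :=
  Matrix.of fun i j => ∫ U : SU N, historyEvolution ρ t U i j ∂haarSU N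

/-- The Pauli matrix `σ_z`. -/
def pauliZ : Matrix (Fin 2) (Fin 2) ℂ := !![1, 0; 0, -1]

/-! Identify SU(2) with the unit quaternions x₀ + x₁i + x₂j + x₃k and write x₀ = cos θ with θ ∈ [0,
π]. If U ≠ −1, the eigenphases of U are ±θ, and exp(−iH_U t) = cos tθ + s·(U − x₀) with s = sin tθ /
sin θ (`SU2.exp_hamiltonianSU`). The point −1 is null because Haar measure has no atoms.

Since ρ(0) = |0⟩⟨0|, the evolved state has diagonal entries cos² tθ + s²x₁² and s²(x₂² + x₃²), and
an off-diagonal entry odd in (x₂, x₃). Conjugation by the quaternion i kills the average of the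
latter. Conjugation by (1 + i + j + k)/2 permutes x₁, x₂, x₃ cyclically, so each s²xₖ² averages to
one third of s²(1 − x₀²) = sin² tθ. Hence n_z(t) = 1 − (4/3) ∫ sin² tθ dU.

The law of θ is (2/π) sin² θ dθ (`SU2.integral_comp_x₀`): invariance under left translation by
diagonal matrices gives a recursion for the moments of x₀, the weight sin² θ satisfies the same
recursion, and Weierstrass approximation passes to continuous functions. An elementary trigonometric
integral remains (`SU2.blochZ_eq`). -/

instance instIsHaarMeasureHaarSU (N : ℕ) : (haarSU N).IsHaarMeasure :=
  Measure.isHaarMeasure_haarMeasure ⊤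

/-- A right translate of Haar measure is again a left-invariant probability measure, so uniqueness
applies. -/
instance instIsMulRightInvariantHaarSU (N : ℕ) : (haarSU N).IsMulRightInvariant where
  map_mul_right_eq_self g := by
    have : IsProbabilityMeasure ((haarSU N).map (· * g)) :=
      Measure.isProbabilityMeasure_map (measurable_mul_const g).aemeasurable
    exact Measure.isHaarMeasure_eq_of_isProbabilityMeasure _ _

theorem integral_conj_haarSU {N : ℕ} {E : Type*} [NormedAddCommGroup E] [NormedSpace ℝ E]
    (g : SU N) (f : SU N → E) :
    ∫ U, f (g * U * g⁻¹) ∂haarSU N = ∫ U, f U ∂haarSU N := by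
  rw [integral_mul_left_eq_self (fun U => f (U * g⁻¹)) g, integral_mul_right_eq_self f g⁻¹]

theorem integrable_haarSU_of_continuous {N : ℕ} {f : SU N → ℝ} (hf : Continuous f) :
    Integrable f (haarSU N) :=
  hf.integrable_of_hasCompactSupport (HasCompactSupport.of_compactSpace f)

/-! ### Quaternionic coordinates on SU(2) -/

namespace SU2

/-- The element of `SU(2)` with first row `(a, b)`. -/
def mk (a b : ℂ) (h : a * star a + b * star b = 1) : SU 2 :=
  ⟨!![a, b; -star b, star a], by
    rw [Matrix.mem_specialUnitaryGroup_iff, Matrix.mem_unitaryGroup_iff]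
    constructor
    · ext i j
      fin_cases i <;> fin_cases j <;>
        simp [Matrix.mul_apply, Fin.sum_univ_two, Matrix.star_apply] at h ⊢ <;>
        first | linear_combination h | ring
    · simp [Matrix.det_fin_two_of] at h ⊢
      linear_combination h⟩

/-- The real quaternionic coordinate of an element of `SU(2)`. -/
def x₀ (U : SU 2) : ℝ := (U.1 0 0).re

/-- The first imaginary quaternionic coordinate of an element of `SU(2)`. -/
def x₁ (U : SU 2) : ℝ := (U.1 0 0).im

/-- The second imaginary quaternionic coordinate of an element of `SU(2)`. -/
def x₂ (U : SU 2) : ℝ := (U.1 0 1).re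

/-- The third imaginary quaternionic coordinate of an element of `SU(2)`. -/
def x₃ (U : SU 2) : ℝ := (U.1 0 1).im

/-- The conjugate transpose and, as the determinant is 1, the adjugate are both inverse to U;
entries are then compared. -/
theorem val_one_one (U : SU 2) : U.1 1 1 = star (U.1 0 0) := by
  have h := (Matrix.mem_specialUnitaryGroup_iff.mp U.2)
  have e : star U.1 = U.1.adjugate := by
    have h1 : star U.1 * U.1 = 1 := Matrix.mem_unitaryGroup_iff'.mp h.1
    have h2 : U.1 * U.1.adjugate = 1 := by rw [Matrix.mul_adjugate, h.2, one_smul]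
    exact left_inv_eq_right_inv h1 h2
  have := congrFun (congrFun e 0) 0
  rw [Matrix.adjugate_fin_two] at this
  simpa [Matrix.star_apply] using this.symm

theorem val_one_zero (U : SU 2) : U.1 1 0 = -star (U.1 0 1) := by
  have h := (Matrix.mem_specialUnitaryGroup_iff.mp U.2)
  have e : star U.1 = U.1.adjugate := by
    have h1 : star U.1 * U.1 = 1 := Matrix.mem_unitaryGroup_iff'.mp h.1
    have h2 : U.1 * U.1.adjugate = 1 := by rw [Matrix.mul_adjugate, h.2, one_smul]
    exact left_inv_eq_right_inv h1 h2
  have := congrFun (congrFun e 1) 0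
  rw [Matrix.adjugate_fin_two] at this
  simp [Matrix.star_apply] at this
  simp [this]

theorem val_zero_zero (U : SU 2) : U.1 0 0 = x₀ U + x₁ U * Complex.I :=
  (Complex.re_add_im _).symm

theorem val_zero_one (U : SU 2) : U.1 0 1 = x₂ U + x₃ U * Complex.I :=
  (Complex.re_add_im _).symm

theorem val_one_one' (U : SU 2) : U.1 1 1 = x₀ U - x₁ U * Complex.I := by
  rw [val_one_one, val_zero_zero]; simp; ring

theorem val_one_zero' (U : SU 2) : U.1 1 0 = -x₂ U + x₃ U * Complex.I := by
  rw [val_one_zero, val_zero_one]; simp; ring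

theorem sum_sq (U : SU 2) : x₀ U ^ 2 + x₁ U ^ 2 + x₂ U ^ 2 + x₃ U ^ 2 = 1 := by
  have h := (Matrix.mem_specialUnitaryGroup_iff.mp U.2).2
  rw [Matrix.det_fin_two, val_zero_zero, val_zero_one, val_one_one', val_one_zero'] at h
  have := congrArg Complex.re h
  simp at this
  linarith

theorem ext_coord {U V : SU 2} (h0 : x₀ U = x₀ V) (h1 : x₁ U = x₁ V) (h2 : x₂ U = x₂ V)
    (h3 : x₃ U = x₃ V) : U = V := by
  apply Subtype.ext
  ext i j
  fin_cases i <;> fin_cases j <;>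
    simp [val_zero_zero, val_zero_one, val_one_one', val_one_zero', h0, h1, h2, h3]

@[fun_prop] theorem continuous_x₀ : Continuous x₀ :=
  Complex.continuous_re.comp (continuous_subtype_val.matrix_elem 0 0)
@[fun_prop] theorem continuous_x₁ : Continuous x₁ :=
  Complex.continuous_im.comp (continuous_subtype_val.matrix_elem 0 0)
@[fun_prop] theorem continuous_x₂ : Continuous x₂ :=
  Complex.continuous_re.comp (continuous_subtype_val.matrix_elem 0 1)
@[fun_prop] theorem continuous_x₃ : Continuous x₃ :=
  Complex.continuous_im.comp (continuous_subtype_val.matrix_elem 0 1)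

theorem x₀_mem (U : SU 2) : x₀ U ∈ Set.Icc (-1 : ℝ) 1 := by
  rw [Set.mem_Icc, ← abs_le, ← sq_le_one_iff_abs_le_one]
  nlinarith [sum_sq U, sq_nonneg (x₁ U), sq_nonneg (x₂ U), sq_nonneg (x₃ U)]

theorem x₀_mul (U V : SU 2) :
    x₀ (U * V) = x₀ U * x₀ V - x₁ U * x₁ V - x₂ U * x₂ V - x₃ U * x₃ V := by
  have : (U * V).1 0 0 = U.1 0 0 * V.1 0 0 + U.1 0 1 * V.1 1 0 := by
    simp [Matrix.mul_apply, Fin.sum_univ_two]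
  rw [x₀, this, val_zero_zero, val_zero_one, val_zero_zero, val_one_zero']
  simp; ring

theorem x₁_mul (U V : SU 2) :
    x₁ (U * V) = x₀ U * x₁ V + x₁ U * x₀ V + x₂ U * x₃ V - x₃ U * x₂ V := by
  have : (U * V).1 0 0 = U.1 0 0 * V.1 0 0 + U.1 0 1 * V.1 1 0 := by
    simp [Matrix.mul_apply, Fin.sum_univ_two]
  rw [x₁, this, val_zero_zero, val_zero_one, val_zero_zero, val_one_zero']
  simp; ring

theorem x₂_mul (U V : SU 2) :
    x₂ (U * V) = x₀ U * x₂ V + x₂ U * x₀ V + x₃ U * x₁ V - x₁ U * x₃ V := by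
  have : (U * V).1 0 1 = U.1 0 0 * V.1 0 1 + U.1 0 1 * V.1 1 1 := by
    simp [Matrix.mul_apply, Fin.sum_univ_two]
  rw [x₂, this, val_zero_zero, val_zero_one, val_zero_one, val_one_one']
  simp; ring

theorem x₃_mul (U V : SU 2) :
    x₃ (U * V) = x₀ U * x₃ V + x₃ U * x₀ V + x₁ U * x₂ V - x₂ U * x₁ V := by
  have : (U * V).1 0 1 = U.1 0 0 * V.1 0 1 + U.1 0 1 * V.1 1 1 := by
    simp [Matrix.mul_apply, Fin.sum_univ_two]
  rw [x₃, this, val_zero_zero, val_zero_one, val_zero_one, val_one_one']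
  simp; ring

theorem inv_val (U : SU 2) : (U⁻¹).1 = star U.1 := rfl

theorem x₀_inv (U : SU 2) : x₀ U⁻¹ = x₀ U := by
  simp [x₀, inv_val, Matrix.star_apply]
theorem x₁_inv (U : SU 2) : x₁ U⁻¹ = -x₁ U := by
  simp [x₁, inv_val, Matrix.star_apply]
theorem x₂_inv (U : SU 2) : x₂ U⁻¹ = -x₂ U := by
  rw [x₂, inv_val, Matrix.star_apply, val_one_zero']; simp
theorem x₃_inv (U : SU 2) : x₃ U⁻¹ = -x₃ U := by
  rw [x₃, inv_val, Matrix.star_apply, val_one_zero']; simp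

/-! ### Symmetries of the Haar integral -/

/-- Integrals over `SU(2)` are invariant under cyclic permutations of the imaginary coordinates. -/
theorem integral_cyclic (f : ℝ → ℝ → ℝ → ℝ → ℝ) :
    ∫ U, f (x₀ U) (x₃ U) (x₁ U) (x₂ U) ∂haarSU 2 =
      ∫ U, f (x₀ U) (x₁ U) (x₂ U) (x₃ U) ∂haarSU 2 := by
  -- The quaternion (1 + i + j + k)/2; conjugation by it is the third of a turn about the axis (1,
  -- 1, 1).
  let g : SU 2 := mk ((1 + Complex.I) / 2) ((1 + Complex.I) / 2) (by
    apply Complex.ext <;> simp <;> norm_num)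
  have g0 : x₀ g = 1 / 2 := by simp [g, mk, x₀]
  have g1 : x₁ g = 1 / 2 := by simp [g, mk, x₁]
  have g2 : x₂ g = 1 / 2 := by simp [g, mk, x₂]
  have g3 : x₃ g = 1 / 2 := by simp [g, mk, x₃]
  rw [← integral_conj_haarSU g (fun U => f (x₀ U) (x₁ U) (x₂ U) (x₃ U))]
  congr 1
  funext U
  simp only [x₀_mul, x₁_mul, x₂_mul, x₃_mul, x₀_inv, x₁_inv, x₂_inv, x₃_inv, g0, g1, g2, g3]
  congr 1 <;> ring

/-- Integrals over `SU(2)` are invariant under the rotation by `π` about the first axis. -/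
theorem integral_neg {E : Type*} [NormedAddCommGroup E] [NormedSpace ℝ E]
    (f : ℝ → ℝ → ℝ → ℝ → E) :
    ∫ U, f (x₀ U) (x₁ U) (-x₂ U) (-x₃ U) ∂haarSU 2 =
      ∫ U, f (x₀ U) (x₁ U) (x₂ U) (x₃ U) ∂haarSU 2 := by
  -- The quaternion i, which commutes with i and anticommutes with j and k.
  let g : SU 2 := mk Complex.I 0 (by simp)
  have g0 : x₀ g = 0 := by simp [g, mk, x₀]
  have g1 : x₁ g = 1 := by simp [g, mk, x₁]
  have g2 : x₂ g = 0 := by simp [g, mk, x₂]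
  have g3 : x₃ g = 0 := by simp [g, mk, x₃]
  rw [← integral_conj_haarSU g (fun U => f (x₀ U) (x₁ U) (x₂ U) (x₃ U))]
  congr 1
  funext U
  simp only [x₀_mul, x₁_mul, x₂_mul, x₃_mul, x₀_inv, x₁_inv, x₂_inv, x₃_inv, g0, g1, g2, g3]
  congr 1 <;> ring

/-- The one-parameter subgroup of diagonal matrices. -/
noncomputable def diag (φ : ℝ) : SU 2 := mk (Real.cos φ + Real.sin φ * Complex.I) 0 (by
  have := Real.sin_sq_add_cos_sq φ
  apply Complex.ext <;> simp [-Complex.ofReal_cos, -Complex.ofReal_sin] <;> nlinarith)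

theorem x₀_diag (φ : ℝ) : x₀ (diag φ) = Real.cos φ := by
  simp [diag, mk, x₀, -Complex.ofReal_cos, -Complex.ofReal_sin]
theorem x₁_diag (φ : ℝ) : x₁ (diag φ) = Real.sin φ := by
  simp [diag, mk, x₁, -Complex.ofReal_cos, -Complex.ofReal_sin]
theorem x₂_diag (φ : ℝ) : x₂ (diag φ) = 0 := by simp [diag, mk, x₂]
theorem x₃_diag (φ : ℝ) : x₃ (diag φ) = 0 := by simp [diag, mk, x₃]

/-- Integrals over `SU(2)` are invariant under rotations in the plane of the first two
coordinates. -/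
theorem integral_rotate (φ : ℝ) (f : ℝ → ℝ → ℝ) :
    ∫ U, f (Real.cos φ * x₀ U - Real.sin φ * x₁ U) (Real.sin φ * x₀ U + Real.cos φ * x₁ U)
      ∂haarSU 2 = ∫ U, f (x₀ U) (x₁ U) ∂haarSU 2 := by
  rw [← integral_mul_left_eq_self (fun U => f (x₀ U) (x₁ U)) (diag φ)]
  congr 1
  funext U
  simp only [x₀_mul, x₁_mul, x₀_diag, x₁_diag, x₂_diag, x₃_diag]
  congr 1 <;> ring

theorem continuous_diag : Continuous diag := by
  refine Continuous.subtype_mk (continuous_matrix fun i j => ?_) _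
  fin_cases i <;> fin_cases j <;> simp <;> fun_prop

theorem diag_zero : diag 0 = 1 :=
  ext_coord (by rw [x₀_diag]; simp [x₀]) (by rw [x₁_diag]; simp [x₁])
    (by rw [x₂_diag]; simp [x₂]) (by rw [x₃_diag]; simp [x₃])

/-! ### Absence of atoms -/

open Filter Topology in
-- The identity is not isolated, being the limit of `diag φ` as φ decreases to 0. Haar measure
-- therefore has no atoms.
instance instNeBotNhdsNeOne : (𝓝[≠] (1 : SU 2)).NeBot := by
  have h : Tendsto diag (𝓝[>] 0) (𝓝[≠] 1) := by
    refine tendsto_nhdsWithin_iff.mpr ⟨?_, ?_⟩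
    · rw [← diag_zero]
      exact continuous_diag.continuousAt.tendsto.mono_left nhdsWithin_le_nhds
    · filter_upwards [Ioo_mem_nhdsGT Real.pi_pos] with φ hφ h
      have h1 : x₁ (diag φ) = x₁ 1 := congrArg x₁ h
      rw [x₁_diag] at h1
      simp [x₁] at h1
      exact (Real.sin_pos_of_mem_Ioo hφ).ne' h1
  exact h.neBot

/-- Almost every element of `SU(2)` differs from `-1`. -/
theorem ae_neg_one_lt_x₀ : ∀ᵐ U ∂haarSU 2, -1 < x₀ U := by
  -- `diag π` is −1, the only point of the sphere with x₀ = −1.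
  have : ∀ᵐ U ∂haarSU 2, U ≠ diag Real.pi := by
    rw [ae_iff]; simp
  filter_upwards [this] with U hU
  refine lt_of_le_of_ne (x₀_mem U).1 fun h => hU ?_
  have hs := sum_sq U
  rw [← h] at hs
  have h1 : x₁ U = 0 := by
    nlinarith [sq_nonneg (x₁ U), sq_nonneg (x₂ U), sq_nonneg (x₃ U)]
  have h2 : x₂ U = 0 := by
    nlinarith [sq_nonneg (x₁ U), sq_nonneg (x₂ U), sq_nonneg (x₃ U)]
  have h3 : x₃ U = 0 := by
    nlinarith [sq_nonneg (x₁ U), sq_nonneg (x₂ U), sq_nonneg (x₃ U)]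
  exact ext_coord (by simp [← h, x₀_diag]) (by simp [h1, x₁_diag]) (by simp [h2, x₂_diag])
    (by simp [h3, x₃_diag])

/-! ### Moments of x₀ and the Weyl integration formula -/

/-- The integral of x₀ⁿ⁺¹x₁ does not change when (x₀, x₁) is rotated by φ; its derivative in φ at 0
must vanish. -/
theorem moment_x₁_sq (n : ℕ) :
    (n + 1) * ∫ U, x₀ U ^ n * x₁ U ^ 2 ∂haarSU 2 = ∫ U, x₀ U ^ (n + 2) ∂haarSU 2 := by
  let p : ℝ → SU 2 → ℝ := fun φ U => Real.cos φ * x₀ U - Real.sin φ * x₁ U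
  let q : ℝ → SU 2 → ℝ := fun φ U => Real.sin φ * x₀ U + Real.cos φ * x₁ U
  let F : ℝ → SU 2 → ℝ := fun φ U => p φ U ^ (n + 1) * q φ U
  let F' : ℝ → SU 2 → ℝ := fun φ U =>
    ((n + 1 : ℕ) * p φ U ^ n * (-q φ U)) * q φ U + p φ U ^ (n + 1) * p φ U
  have hp : ∀ φ, Continuous (p φ) := fun φ => by fun_prop
  have hq : ∀ φ, Continuous (q φ) := fun φ => by fun_prop
  have hF : ∀ φ, Continuous (F φ) := fun φ => ((hp φ).pow _).mul (hq φ)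
  have hF' : ∀ φ, Continuous (F' φ) := fun φ =>
    ((continuous_const.mul ((hp φ).pow _)).mul (hq φ).neg).mul (hq φ) |>.add
      (((hp φ).pow _).mul (hp φ))
  have hpd : ∀ φ U, HasDerivAt (fun φ => p φ U) (-q φ U) φ := fun φ U => by
    exact (((Real.hasDerivAt_cos φ).mul_const (x₀ U)).sub
      ((Real.hasDerivAt_sin φ).mul_const (x₁ U))).congr_deriv (by simp only [q]; ring)
  have hqd : ∀ φ U, HasDerivAt (fun φ => q φ U) (p φ U) φ := fun φ U => by
    exact (((Real.hasDerivAt_sin φ).mul_const (x₀ U)).add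
      ((Real.hasDerivAt_cos φ).mul_const (x₁ U))).congr_deriv (by simp only [p]; ring)
  have hpq : ∀ φ U, p φ U ^ 2 + q φ U ^ 2 ≤ 1 := fun φ U => by
    have e : p φ U ^ 2 + q φ U ^ 2 = x₀ U ^ 2 + x₁ U ^ 2 := by
      simp only [p, q]
      linear_combination (x₀ U ^ 2 + x₁ U ^ 2) * Real.sin_sq_add_cos_sq φ
    rw [e]
    nlinarith [sum_sq U, sq_nonneg (x₂ U), sq_nonneg (x₃ U)]
  have hp1 : ∀ φ U, |p φ U| ≤ 1 := fun φ U => by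
    rw [← sq_le_one_iff_abs_le_one]; nlinarith [hpq φ U, sq_nonneg (q φ U)]
  have hq1 : ∀ φ U, |q φ U| ≤ 1 := fun φ U => by
    rw [← sq_le_one_iff_abs_le_one]; nlinarith [hpq φ U, sq_nonneg (p φ U)]
  -- Since |p| ≤ 1 and |q| ≤ 1, the two summands of F' are bounded by n + 1 and 1.
  have key := (hasDerivAt_integral_of_dominated_loc_of_deriv_le (μ := haarSU 2) (F := F) (F' := F')
    (x₀ := (0 : ℝ)) (s := Set.univ) (bound := fun _ => (n + 1 : ℕ) + 1) Filter.univ_mem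
    (Filter.Eventually.of_forall fun φ => (hF φ).aestronglyMeasurable)
    (integrable_haarSU_of_continuous (hF 0)) (hF' 0).aestronglyMeasurable
    (Filter.Eventually.of_forall fun U φ _ => by
      have a1 : |p φ U| ^ n ≤ 1 := pow_le_one₀ (abs_nonneg _) (hp1 φ U)
      have a2 : |p φ U| ^ (n + 1) ≤ 1 := pow_le_one₀ (abs_nonneg _) (hp1 φ U)
      refine (norm_add_le _ _).trans (add_le_add ?_ ?_)
      · simp only [norm_mul, norm_pow, Real.norm_eq_abs, abs_neg, Nat.abs_cast]
        have a3 : |q φ U| * |q φ U| ≤ 1 := mul_le_one₀ (hq1 φ U) (abs_nonneg _) (hq1 φ U)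
        have a4 : |p φ U| ^ n * (|q φ U| * |q φ U|) ≤ 1 := mul_le_one₀ a1 (by positivity) a3
        calc _ = ((n + 1 : ℕ) : ℝ) * (|p φ U| ^ n * (|q φ U| * |q φ U|)) := by ring
          _ ≤ ((n + 1 : ℕ) : ℝ) * 1 := by gcongr
          _ = _ := mul_one _
      · simp only [norm_mul, norm_pow, Real.norm_eq_abs]
        exact mul_le_one₀ a2 (abs_nonneg _) (hp1 φ U))
    (integrable_const _)
    (Filter.Eventually.of_forall fun U φ _ => ((hpd φ U).pow (n + 1)).mul (hqd φ U))).2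
  have hconst : (fun φ => ∫ U, F φ U ∂haarSU 2) = fun _ => ∫ U, x₀ U ^ (n + 1) * x₁ U ∂haarSU 2 :=
    funext fun φ => integral_rotate φ fun a b => a ^ (n + 1) * b
  rw [hconst] at key
  have h0 := key.unique (hasDerivAt_const _ _)
  have e : F' 0 = fun U => x₀ U ^ (n + 2) - (n + 1) * (x₀ U ^ n * x₁ U ^ 2) := by
    funext U; simp [F', p, q]; ring
  rw [e, integral_sub (integrable_haarSU_of_continuous (by fun_prop))
    (integrable_haarSU_of_continuous (by fun_prop)), integral_const_mul] at h0
  linarith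

theorem integral_x₁_sq_eq_x₂_sq (g : ℝ → ℝ) :
    ∫ U, g (x₀ U) * x₁ U ^ 2 ∂haarSU 2 = ∫ U, g (x₀ U) * x₂ U ^ 2 ∂haarSU 2 :=
  integral_cyclic fun a _ c _ => g a * c ^ 2

theorem integral_x₂_sq_eq_x₃_sq (g : ℝ → ℝ) :
    ∫ U, g (x₀ U) * x₂ U ^ 2 ∂haarSU 2 = ∫ U, g (x₀ U) * x₃ U ^ 2 ∂haarSU 2 :=
  integral_cyclic fun a _ _ d => g a * d ^ 2

/-- Integrate x₀ⁿ times the sphere equation: the three imaginary squares contribute equally, and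
`moment_x₁_sq` evaluates each as the (n+2)-nd moment over n + 1. -/
theorem moment_x₀_succ_succ (n : ℕ) :
    (n + 4) * ∫ U, x₀ U ^ (n + 2) ∂haarSU 2 = (n + 1) * ∫ U, x₀ U ^ n ∂haarSU 2 := by
  have h1 := moment_x₁_sq n
  have h2 := integral_x₁_sq_eq_x₂_sq (· ^ n)
  have h3 := integral_x₂_sq_eq_x₃_sq (· ^ n)
  have hi : ∀ f : SU 2 → ℝ, Continuous f → Integrable f (haarSU 2) :=
    fun _ => integrable_haarSU_of_continuous
  have e : ∫ U, x₀ U ^ n ∂haarSU 2 = ∫ U, x₀ U ^ (n + 2) ∂haarSU 2 +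
      ∫ U, x₀ U ^ n * x₁ U ^ 2 ∂haarSU 2 + ∫ U, x₀ U ^ n * x₂ U ^ 2 ∂haarSU 2 +
      ∫ U, x₀ U ^ n * x₃ U ^ 2 ∂haarSU 2 := by
    rw [← integral_add (hi _ (by fun_prop)) (hi _ (by fun_prop)),
      ← integral_add (hi _ (by fun_prop)) (hi _ (by fun_prop)),
      ← integral_add (hi _ (by fun_prop)) (hi _ (by fun_prop))]
    congr 1
    funext U
    linear_combination -(x₀ U ^ n) * sum_sq U
  rw [e, ← h3, ← h2]
  linear_combination -3 * h1

theorem moment_x₀_one : ∫ U, x₀ U ∂haarSU 2 = 0 := by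
  have := integral_rotate Real.pi fun a _ => a
  simp only [Real.cos_pi, Real.sin_pi, zero_mul, sub_zero, neg_one_mul] at this
  rw [MeasureTheory.integral_neg] at this
  linarith

/-- The function cosⁿ⁺¹θ sin³θ vanishes at both endpoints, so its derivative integrates to zero.
This is the recursion of `moment_x₀_succ_succ`. -/
theorem integral_cos_pow_mul_sin_sq_succ_succ (n : ℕ) :
    (n + 4) * ∫ θ in 0..Real.pi, Real.cos θ ^ (n + 2) * Real.sin θ ^ 2 =
      (n + 1) * ∫ θ in 0..Real.pi, Real.cos θ ^ n * Real.sin θ ^ 2 := by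
  have h := intervalIntegral.integral_eq_sub_of_hasDerivAt (a := 0) (b := Real.pi)
    (f := fun θ => Real.cos θ ^ (n + 1) * Real.sin θ ^ 3)
    (f' := fun θ => (n + 4) * (Real.cos θ ^ (n + 2) * Real.sin θ ^ 2) -
      (n + 1) * (Real.cos θ ^ n * Real.sin θ ^ 2)) (fun θ _ => by
        refine (((Real.hasDerivAt_cos θ).pow (n + 1)).mul
          ((Real.hasDerivAt_sin θ).pow 3)).congr_deriv ?_
        simp
        linear_combination -(n + 1) * Real.cos θ ^ n * Real.sin θ ^ 2 * Real.sin_sq θ)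
      (Continuous.intervalIntegrable (by fun_prop) _ _)
  rw [intervalIntegral.integral_sub (Continuous.intervalIntegrable (by fun_prop) _ _)
    (Continuous.intervalIntegrable (by fun_prop) _ _), intervalIntegral.integral_const_mul,
    intervalIntegral.integral_const_mul] at h
  simp at h
  linarith

theorem moment_x₀ (n : ℕ) : ∫ U, x₀ U ^ n ∂haarSU 2 =
    2 / Real.pi * ∫ θ in 0..Real.pi, Real.cos θ ^ n * Real.sin θ ^ 2 := by
  induction n using Nat.twoStepInduction with
  | zero => simp [integral_sin_sq]
  | one =>
    simp only [pow_one, moment_x₀_one]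
    have h := intervalIntegral.integral_eq_sub_of_hasDerivAt (a := 0) (b := Real.pi)
      (f := fun θ => Real.sin θ ^ 3 / 3)
      (f' := fun θ => Real.cos θ * Real.sin θ ^ 2) (fun θ _ => by
        refine (((Real.hasDerivAt_sin θ).pow 3).div_const 3).congr_deriv ?_
        simp; ring)
      (Continuous.intervalIntegrable (by fun_prop) _ _)
    simp [h]
  | more n h _ =>
    have h1 := moment_x₀_succ_succ n
    have h2 := integral_cos_pow_mul_sin_sq_succ_succ n
    have h4 : (n + 4 : ℝ) ≠ 0 := by positivity
    apply mul_left_cancel₀ h4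
    rw [h1, h]
    linear_combination -(2 / Real.pi) * h2

theorem integral_eval_x₀ (p : Polynomial ℝ) : ∫ U, p.eval (x₀ U) ∂haarSU 2 =
    2 / Real.pi * ∫ θ in 0..Real.pi, p.eval (Real.cos θ) * Real.sin θ ^ 2 := by
  induction p using Polynomial.induction_on' with
  | add p q hp hq =>
    simp only [Polynomial.eval_add, add_mul]
    rw [integral_add (integrable_haarSU_of_continuous (by fun_prop))
      (integrable_haarSU_of_continuous (by fun_prop)), intervalIntegral.integral_add
      (Continuous.intervalIntegrable (by fun_prop) _ _)
      (Continuous.intervalIntegrable (by fun_prop) _ _), hp, hq, mul_add]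
  | monomial n a =>
    simp only [Polynomial.eval_monomial, mul_assoc]
    rw [integral_const_mul, intervalIntegral.integral_const_mul, moment_x₀]
    ring

/-- The Weyl integration formula for class functions on `SU(2)`. -/
theorem integral_comp_x₀ {h : ℝ → ℝ} (hh : Continuous h) : ∫ U, h (x₀ U) ∂haarSU 2 =
    2 / Real.pi * ∫ θ in 0..Real.pi, h (Real.cos θ) * Real.sin θ ^ 2 := by
  refine eq_of_forall_dist_le fun ε hε => ?_
  -- An error ε/3 in the polynomial costs ε/3 on the group and at most (2/π)·π·ε/3 = 2ε/3 on the
  -- interval, in total ε.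
  obtain ⟨p, hp⟩ := exists_polynomial_near_of_continuousOn (-1) 1 h hh.continuousOn (ε / 3)
    (by positivity)
  have e1 : |∫ U, p.eval (x₀ U) ∂haarSU 2 - ∫ U, h (x₀ U) ∂haarSU 2| ≤ ε / 3 := by
    rw [← integral_sub (integrable_haarSU_of_continuous (by fun_prop))
      (integrable_haarSU_of_continuous (by fun_prop))]
    refine (norm_integral_le_of_norm_le_const (C := ε / 3)
      (f := fun U => p.eval (x₀ U) - h (x₀ U))
      (Filter.Eventually.of_forall fun U => (hp (x₀ U) (x₀_mem U)).le)).trans ?_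
    simp
  have e2 : |∫ θ in 0..Real.pi, (p.eval (Real.cos θ) - h (Real.cos θ)) * Real.sin θ ^ 2| ≤
      ε / 3 * |Real.pi - 0| :=
    intervalIntegral.norm_integral_le_of_norm_le_const (f := fun θ =>
      (p.eval (Real.cos θ) - h (Real.cos θ)) * Real.sin θ ^ 2) fun θ _ => by
      rw [norm_mul, Real.norm_eq_abs, Real.norm_eq_abs, abs_of_nonneg (sq_nonneg (Real.sin θ))]
      exact (mul_le_of_le_one_right (abs_nonneg _) (Real.sin_sq_le_one θ)).trans
        (hp _ ⟨Real.neg_one_le_cos θ, Real.cos_le_one θ⟩).le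
  simp only [sub_mul] at e2
  rw [intervalIntegral.integral_sub (Continuous.intervalIntegrable (by fun_prop) _ _)
    (Continuous.intervalIntegrable (by fun_prop) _ _), sub_zero, abs_of_pos Real.pi_pos] at e2
  rw [integral_eval_x₀] at e1
  have hpi := Real.pi_pos
  have e3 := mul_le_mul_of_nonneg_left e2 (by positivity : 0 ≤ 2 / Real.pi)
  rw [← abs_of_pos (by positivity : 0 < 2 / Real.pi), ← abs_mul,
    abs_of_pos (by positivity : 0 < 2 / Real.pi), mul_sub] at e3
  have e4 : 2 / Real.pi * (ε / 3 * Real.pi) = 2 * (ε / 3) := by field_simp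
  rw [e4] at e3
  rw [Real.dist_eq, abs_le]
  rw [abs_le] at e1 e3
  constructor <;> linarith [e1.1, e1.2, e3.1, e3.2]

/-! ### The exponential of the principal Hamiltonian -/

theorem exp_smul_conj_diagonal {N : ℕ} {V : Matrix (Fin N) (Fin N) ℂ}
    (hV : V ∈ Matrix.unitaryGroup (Fin N) ℂ) (d : Fin N → ℂ) (z : ℂ) :
    NormedSpace.exp (z • (V * Matrix.diagonal d * star V)) =
      V * Matrix.diagonal (fun j => Complex.exp (z * d j)) * star V := by
  have e1 : star V * V = 1 := Matrix.mem_unitaryGroup_iff'.mp hV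
  have hinv : star V = V⁻¹ := (Matrix.inv_eq_left_inv e1).symm
  have hunit : IsUnit V :=
    (Matrix.isUnit_iff_isUnit_det _).mpr (Matrix.isUnit_det_of_left_inverse e1)
  rw [← smul_mul_assoc, ← mul_smul_comm, hinv, Matrix.exp_conj _ _ hunit, ← Matrix.diagonal_smul,
    Matrix.exp_diagonal]
  congr 3
  funext j
  rw [Pi.coe_exp, ← Complex.exp_eq_exp_ℂ]
  simp

/-- Here arccos (cos d) = |d|, and the sign of d cancels between the two sines. At d = 0 both sides
are 0. -/
theorem sin_mul_arccos_cos {d : ℝ} (h : -Real.pi < d) (h' : d < Real.pi) (t : ℝ) :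
    Real.sin (t * Real.arccos (Real.cos d)) / √(1 - Real.cos d ^ 2) * Real.sin d =
      Real.sin (t * d) := by
  have e : √(1 - Real.cos d ^ 2) = |Real.sin d| := by
    rw [← Real.sin_sq, Real.sqrt_sq_eq_abs]
  rw [e]
  rcases lt_trichotomy d 0 with hd | rfl | hd
  · have hs := Real.sin_neg_of_neg_of_neg_pi_lt hd h
    rw [← Real.cos_neg d, Real.arccos_cos (by linarith) (by linarith), abs_of_neg hs, mul_neg,
      Real.sin_neg, neg_div_neg_eq, div_mul_cancel₀ _ hs.ne]
  · simp
  · have hs := Real.sin_pos_of_pos_of_lt_pi hd h'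
    rw [Real.arccos_cos hd.le h'.le, abs_of_pos hs, div_mul_cancel₀ _ hs.ne']

theorem cos_mul_arccos_cos {d : ℝ} (h : -Real.pi < d) (h' : d < Real.pi) (t : ℝ) :
    Real.cos (t * Real.arccos (Real.cos d)) = Real.cos (t * d) := by
  rcases le_total d 0 with hd | hd
  · rw [← Real.cos_neg d, Real.arccos_cos (by linarith) (by linarith), mul_neg, Real.cos_neg]
  · rw [Real.arccos_cos hd h'.le]

/-- The power e^{−itd} is affine in e^{−id} with coefficients depending only on cos d. Opposite
phases thus share them, which lets the identity pass from eigenvalues to matrices. -/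
theorem exp_mul_arccos_cos {d : ℝ} (h : -Real.pi < d) (h' : d < Real.pi) (t : ℝ) :
    Complex.exp (-(Complex.I * t) * d) = (Real.cos (t * Real.arccos (Real.cos d)) : ℝ) +
      (Real.sin (t * Real.arccos (Real.cos d)) / √(1 - Real.cos d ^ 2) : ℝ) *
        (Complex.exp (-(Complex.I * d)) - (Real.cos d : ℝ)) := by
  have e : ∀ x : ℝ, Complex.exp (-(Complex.I * x)) =
      (Real.cos x : ℝ) - (Real.sin x : ℝ) * Complex.I := fun x => by
    rw [show -(Complex.I * (x : ℂ)) = ((-x : ℝ) : ℂ) * Complex.I by push_cast; ring,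
      Complex.exp_mul_I, ← Complex.ofReal_cos, ← Complex.ofReal_sin, Real.cos_neg, Real.sin_neg]
    push_cast; ring
  rw [show -(Complex.I * (t : ℂ)) * d = -(Complex.I * ((t * d : ℝ) : ℂ)) by push_cast; ring, e, e,
    cos_mul_arccos_cos h h', ← sin_mul_arccos_cos h h' t]
  push_cast; ring

/-- The eigenphases of an element of `SU(2)` different from `-1` are opposite. -/
theorem exists_eigenphase {U : SU 2} (hU : -1 < x₀ U) :
    ∃ V ∈ Matrix.unitaryGroup (Fin 2) ℂ, ∃ d : Fin 2 → ℝ,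
      (∀ j, -Real.pi < d j ∧ d j < Real.pi) ∧ (∀ j, Real.cos (d j) = x₀ U) ∧
      U.1 = V * Matrix.diagonal (fun j => Complex.exp (-(Complex.I * (d j : ℂ)))) * star V ∧
      hamiltonianSU U = V * Matrix.diagonal (fun j => (d j : ℂ)) * star V := by
  obtain ⟨V, hV, d, hd, hUV, hH⟩ := hamiltonianSU_spec U
  have e1 : star V * V = 1 := Matrix.mem_unitaryGroup_iff'.mp hV
  have hdet : Complex.exp (-(Complex.I * d 0)) * Complex.exp (-(Complex.I * d 1)) = 1 := by
    have h := (Matrix.mem_specialUnitaryGroup_iff.mp U.2).2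
    rw [hUV, Matrix.det_mul_comm, ← mul_assoc, e1, one_mul] at h
    simpa using h
  have htr : Complex.exp (-(Complex.I * d 0)) + Complex.exp (-(Complex.I * d 1)) = 2 * x₀ U := by
    have h : U.1.trace = 2 * x₀ U := by
      rw [Matrix.trace_fin_two, val_zero_zero, val_one_one']; ring
    rw [hUV, Matrix.trace_mul_comm, ← mul_assoc, e1, one_mul, Matrix.trace_diagonal] at h
    simpa using h
  have hcos : Real.cos (d 0) + Real.cos (d 1) = 2 * x₀ U := by
    have := congrArg Complex.re htr
    simpa [Complex.exp_re] using this
  rw [← Complex.exp_add, Complex.exp_eq_one_iff] at hdet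
  obtain ⟨n, hn⟩ := hdet
  have hsum : d 0 + d 1 = -n * (2 * Real.pi) := by
    have := congrArg Complex.im hn
    simp at this
    linarith
  have hpi := Real.pi_pos
  -- If one phase is π, the sum is a positive multiple of 2π, which forces both to be π; then x₀ =
  -- −1, which is excluded.
  have hnpi : ∀ j, d j ≠ Real.pi := by
    intro j hj
    have hn0 : n < 0 := by
      by_contra! h
      have : (0 : ℝ) ≤ n := by exact_mod_cast h
      have h0 := hd 0
      have h1 := hd 1
      have : 0 < d 0 + d 1 := by
        fin_cases j <;> simp at hj <;> linarith [h0.1, h1.1]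
      nlinarith
    have hn1 : (n : ℝ) ≤ -1 := by exact_mod_cast Int.le_sub_one_of_lt hn0
    have h0 : d 0 = Real.pi := by nlinarith [(hd 0).2, (hd 1).2]
    have h1 : d 1 = Real.pi := by nlinarith [(hd 0).2, (hd 1).2]
    rw [h0, h1, Real.cos_pi] at hcos
    linarith
  have hlt : ∀ j, -Real.pi < d j ∧ d j < Real.pi :=
    fun j => ⟨(hd j).1, lt_of_le_of_ne (hd j).2 (hnpi j)⟩
  -- Now both phases lie strictly between −π and π, so their sum is a multiple of 2π of absolute
  -- value below 2π.
  have hn0 : n = 0 := by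
    have a : (n : ℝ) < 1 := by nlinarith [(hlt 0).1, (hlt 1).1]
    have b : (-1 : ℝ) < n := by nlinarith [(hlt 0).2, (hlt 1).2]
    have a' : n < 1 := by exact_mod_cast a
    have b' : -1 < n := by exact_mod_cast b
    omega
  have hneg : d 1 = -d 0 := by rw [hn0] at hsum; simp at hsum; linarith
  refine ⟨V, hV, d, hlt, ?_, hUV, hH⟩
  rw [hneg, Real.cos_neg] at hcos
  intro j
  fin_cases j
  · simp; linarith
  · simp [hneg]; linarith

/-- `cos (t θ)` for `x = cos θ`. -/
noncomputable def cosCoeff (t x : ℝ) : ℝ := Real.cos (t * Real.arccos x)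

/-- `sin (t θ) / sin θ` for `x = cos θ`. -/
noncomputable def sinCoeff (t x : ℝ) : ℝ := Real.sin (t * Real.arccos x) / √(1 - x ^ 2)

theorem exp_hamiltonianSU {U : SU 2} (hU : -1 < x₀ U) (t : ℝ) :
    NormedSpace.exp ((-(Complex.I * (t : ℂ))) • hamiltonianSU U) =
      (cosCoeff t (x₀ U) : ℂ) • 1 + (sinCoeff t (x₀ U) : ℂ) • (U.1 - (x₀ U : ℂ) • 1) := by
  obtain ⟨V, hV, d, hd, hcos, hUV, hH⟩ := exists_eigenphase hU
  have e2 : V * star V = 1 := Matrix.mem_unitaryGroup_iff.mp hV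
  have hD : Matrix.diagonal (fun j => Complex.exp (-(Complex.I * t) * d j)) =
      (cosCoeff t (x₀ U) : ℂ) • 1 + (sinCoeff t (x₀ U) : ℂ) •
        (Matrix.diagonal (fun j => Complex.exp (-(Complex.I * (d j : ℂ)))) -
          (x₀ U : ℂ) • (1 : Matrix (Fin 2) (Fin 2) ℂ)) := by
    have h : (fun j => Complex.exp (-(Complex.I * t) * d j)) = fun j =>
        (cosCoeff t (x₀ U) : ℂ) + (sinCoeff t (x₀ U) : ℂ) *
          (Complex.exp (-(Complex.I * (d j : ℂ))) - (x₀ U : ℂ)) := by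
      funext j
      rw [exp_mul_arccos_cos (hd j).1 (hd j).2, hcos j, cosCoeff, sinCoeff]
    rw [h]
    ext i j
    by_cases hij : i = j <;> simp [hij]
  rw [hH, exp_smul_conj_diagonal hV, hD, hUV]
  simp only [mul_add, add_mul, mul_sub, sub_mul, mul_smul_comm, smul_mul_assoc, mul_one, e2]

theorem exp_hamiltonianSU' {U : SU 2} (hU : -1 < x₀ U) (t : ℝ) :
    NormedSpace.exp ((Complex.I * (t : ℂ)) • hamiltonianSU U) =
      (cosCoeff t (x₀ U) : ℂ) • 1 - (sinCoeff t (x₀ U) : ℂ) • (U.1 - (x₀ U : ℂ) • 1) := by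
  have h := exp_hamiltonianSU hU (-t)
  have hc : cosCoeff (-t) (x₀ U) = cosCoeff t (x₀ U) := by simp [cosCoeff]
  have hs : sinCoeff (-t) (x₀ U) = -sinCoeff t (x₀ U) := by simp [sinCoeff, neg_div]
  rw [hc, hs] at h
  rw [Complex.ofReal_neg, Complex.ofReal_neg, mul_neg, neg_neg, neg_smul, ← sub_eq_add_neg] at h
  exact h

/-! ### Entries of the evolved state -/

/-- The off-diagonal entry of the evolved state. -/
noncomputable def offDiag (t a b c d : ℝ) : ℂ :=
  sinCoeff t a * (-c + d * Complex.I) * (cosCoeff t a - sinCoeff t a * b * Complex.I)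

/-- The initial state projects onto the first basis vector, so the evolved state is the outer
product of the first column of exp(−iH_U t) with itself. -/
theorem historyEvolution_eq {U : SU 2} (hU : -1 < x₀ U) (t : ℝ) :
    historyEvolution ((1 / 2 : ℂ) • (1 + pauliZ)) t U =
      !![((cosCoeff t (x₀ U) ^ 2 + sinCoeff t (x₀ U) ^ 2 * x₁ U ^ 2 : ℝ) : ℂ),
        star (offDiag t (x₀ U) (x₁ U) (x₂ U) (x₃ U));
        offDiag t (x₀ U) (x₁ U) (x₂ U) (x₃ U),
        ((sinCoeff t (x₀ U) ^ 2 * x₂ U ^ 2 + sinCoeff t (x₀ U) ^ 2 * x₃ U ^ 2 : ℝ) : ℂ)] := by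
  have hρ : (1 / 2 : ℂ) • (1 + pauliZ) = !![1, 0; 0, 0] := by
    ext i j
    fin_cases i <;> fin_cases j <;> simp [pauliZ]; norm_num
  have hI := Complex.I_sq
  rw [historyEvolution, exp_hamiltonianSU hU, exp_hamiltonianSU' hU, hρ]
  ext i j
  fin_cases i <;> fin_cases j <;>
    simp [Matrix.mul_apply, Fin.sum_univ_two, val_zero_zero, val_zero_one, val_one_one',
      val_one_zero', offDiag]
  · linear_combination -(sinCoeff t (x₀ U) : ℂ) ^ 2 * x₁ U ^ 2 * hI
  · ring
  · exact Or.inl (by ring)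
  · linear_combination -(sinCoeff t (x₀ U) : ℂ) ^ 2 * x₃ U ^ 2 * hI

/-! ### Measurability, bounds and integrability -/

@[fun_prop] theorem continuous_cosCoeff (t : ℝ) : Continuous (cosCoeff t) := by
  have := Real.continuous_arccos
  unfold cosCoeff; fun_prop

@[fun_prop] theorem measurable_sinCoeff (t : ℝ) : Measurable (sinCoeff t) := by
  have := Real.continuous_arccos.measurable
  unfold sinCoeff; fun_prop

theorem sinCoeff_sq_mul_le (t : ℝ) {x : ℝ} (hx : x ^ 2 ≤ 1) :
    sinCoeff t x ^ 2 * (1 - x ^ 2) ≤ 1 := by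
  rw [sinCoeff, div_pow, Real.sq_sqrt (by linarith)]
  rcases hx.eq_or_lt with h | h
  · simp [h]
  · rw [div_mul_cancel₀ _ (sub_pos.mpr h).ne']
    exact Real.sin_sq_le_one _

/-- The point −1 must be excluded: there the left side is 0 but the right side is sin² πt. -/
theorem sinCoeff_sq_mul (t : ℝ) {x : ℝ} (hx : -1 < x) (hx' : x ≤ 1) :
    sinCoeff t x ^ 2 * (1 - x ^ 2) = Real.sin (t * Real.arccos x) ^ 2 := by
  rcases hx'.eq_or_lt with rfl | h
  · simp
  · have : 0 < 1 - x ^ 2 := by nlinarith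
    rw [sinCoeff, div_pow, Real.sq_sqrt this.le, div_mul_cancel₀ _ this.ne']

/-- For non-integer t, `sinCoeff t` is unbounded near −1. It always occurs multiplied by an
imaginary coordinate, which is at most √(1 − x₀²) in size. -/
theorem abs_sinCoeff_mul_le (t : ℝ) (U : SU 2) {y : ℝ} (hy : y ^ 2 ≤ 1 - x₀ U ^ 2) :
    |sinCoeff t (x₀ U) * y| ≤ 1 := by
  rw [← sq_le_one_iff_abs_le_one, mul_pow]
  exact (mul_le_mul_of_nonneg_left hy (sq_nonneg _)).trans
    (sinCoeff_sq_mul_le t (by nlinarith [sq_nonneg y]))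

theorem x₁_sq_le (U : SU 2) : x₁ U ^ 2 ≤ 1 - x₀ U ^ 2 := by
  nlinarith [sum_sq U, sq_nonneg (x₂ U), sq_nonneg (x₃ U)]
theorem x₂_sq_le (U : SU 2) : x₂ U ^ 2 ≤ 1 - x₀ U ^ 2 := by
  nlinarith [sum_sq U, sq_nonneg (x₁ U), sq_nonneg (x₃ U)]
theorem x₃_sq_le (U : SU 2) : x₃ U ^ 2 ≤ 1 - x₀ U ^ 2 := by
  nlinarith [sum_sq U, sq_nonneg (x₁ U), sq_nonneg (x₂ U)]

theorem integrable_sinCoeff_sq_mul (t : ℝ) {y : SU 2 → ℝ} (hy : Continuous y)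
    (hy' : ∀ U, y U ^ 2 ≤ 1 - x₀ U ^ 2) :
    Integrable (fun U => sinCoeff t (x₀ U) ^ 2 * y U ^ 2) (haarSU 2) := by
  have h0 := continuous_x₀.measurable
  have h1 := hy.measurable
  refine Integrable.of_bound (Measurable.aestronglyMeasurable (by fun_prop)) 1
    (Filter.Eventually.of_forall fun U => ?_)
  rw [← mul_pow, norm_pow, Real.norm_eq_abs]
  exact pow_le_one₀ (abs_nonneg _) (abs_sinCoeff_mul_le t U (hy' U))

theorem integrable_offDiag (t : ℝ) :
    Integrable (fun U => offDiag t (x₀ U) (x₁ U) (x₂ U) (x₃ U)) (haarSU 2) := by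
  have h0 := continuous_x₀.measurable
  have h1 := continuous_x₁.measurable
  have h2 := continuous_x₂.measurable
  have h3 := continuous_x₃.measurable
  have hc := (continuous_cosCoeff t).measurable
  have hs := measurable_sinCoeff t
  refine Integrable.of_bound (Measurable.aestronglyMeasurable ?_) ((1 + 1) * (1 + 1))
    (Filter.Eventually.of_forall fun U => ?_)
  · unfold offDiag
    fun_prop
  · have b1 := abs_sinCoeff_mul_le t U (x₁_sq_le U)
    have b2 := abs_sinCoeff_mul_le t U (x₂_sq_le U)
    have b3 := abs_sinCoeff_mul_le t U (x₃_sq_le U)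
    have b0 : |cosCoeff t (x₀ U)| ≤ 1 := Real.abs_cos_le_one _
    have e : offDiag t (x₀ U) (x₁ U) (x₂ U) (x₃ U) =
        (((sinCoeff t (x₀ U) * x₃ U : ℝ) : ℂ) * Complex.I - ((sinCoeff t (x₀ U) * x₂ U : ℝ) : ℂ)) *
          ((cosCoeff t (x₀ U) : ℂ) - ((sinCoeff t (x₀ U) * x₁ U : ℝ) : ℂ) * Complex.I) := by
      rw [offDiag]; push_cast; ring
    rw [e, norm_mul]
    refine mul_le_mul ((norm_sub_le _ _).trans (add_le_add ?_ ?_))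
      ((norm_sub_le _ _).trans (add_le_add ?_ ?_)) (norm_nonneg _) (by norm_num)
    all_goals
      simp only [norm_mul, Complex.norm_I, mul_one, Complex.norm_real, Real.norm_eq_abs]
      first | exact b0 | simpa using b1 | simpa using b2 | simpa using b3

/-! ### Haar averages of the entries -/

/-- The integrand is odd under (x₂, x₃) ↦ (−x₂, −x₃), a symmetry of the integral by `integral_neg`.
-/
theorem integral_offDiag (t : ℝ) :
    ∫ U, offDiag t (x₀ U) (x₁ U) (x₂ U) (x₃ U) ∂haarSU 2 = 0 := by
  have h := integral_neg (offDiag t)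
  have e : ∀ a b c d, offDiag t a b (-c) (-d) = -offDiag t a b c d := fun a b c d => by
    simp only [offDiag]; push_cast; ring
  simp only [e] at h
  rw [MeasureTheory.integral_neg] at h
  exact self_eq_neg.mp h.symm

/-- The three imaginary coordinates contribute equally, and together they give `sinCoeff`² · (1 −
x₀²), which is sin² tθ away from −1. -/
theorem three_mul_integral_sinCoeff_sq (t : ℝ) :
    3 * ∫ U, sinCoeff t (x₀ U) ^ 2 * x₁ U ^ 2 ∂haarSU 2 =
      ∫ U, Real.sin (t * Real.arccos (x₀ U)) ^ 2 ∂haarSU 2 := by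
  have h2 := integral_x₁_sq_eq_x₂_sq (fun x => sinCoeff t x ^ 2)
  have h3 := integral_x₂_sq_eq_x₃_sq (fun x => sinCoeff t x ^ 2)
  have i1 := integrable_sinCoeff_sq_mul t continuous_x₁ x₁_sq_le
  have i2 := integrable_sinCoeff_sq_mul t continuous_x₂ x₂_sq_le
  have i3 := integrable_sinCoeff_sq_mul t continuous_x₃ x₃_sq_le
  have e : ∫ U, Real.sin (t * Real.arccos (x₀ U)) ^ 2 ∂haarSU 2 =
      ∫ U, sinCoeff t (x₀ U) ^ 2 * x₁ U ^ 2 + sinCoeff t (x₀ U) ^ 2 * x₂ U ^ 2 +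
        sinCoeff t (x₀ U) ^ 2 * x₃ U ^ 2 ∂haarSU 2 := by
    refine integral_congr_ae ?_
    filter_upwards [ae_neg_one_lt_x₀] with U hU
    rw [← sinCoeff_sq_mul t hU (x₀_mem U).2]
    linear_combination -sinCoeff t (x₀ U) ^ 2 * sum_sq U
  have i12 : Integrable (fun U => sinCoeff t (x₀ U) ^ 2 * x₁ U ^ 2 +
    sinCoeff t (x₀ U) ^ 2 * x₂ U ^ 2) (haarSU 2) := i1.add i2
  rw [e, integral_add i12 i3, integral_add i1 i2, ← h3, ← h2]
  ring

/-- The Bloch vector component `n_z(t)`. -/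
noncomputable def blochZ (t : ℝ) : ℝ :=
  1 - 8 / (3 * Real.pi) * ∫ θ in 0..Real.pi, Real.sin (t * θ) ^ 2 * Real.sin θ ^ 2

/-- This explains the constant in `blochZ`: 1/3 comes from the cyclic symmetry, 2/π from the Weyl
formula, and 4 · (1/3) · (2/π) = 8/(3π). -/
theorem integral_sinCoeff_sq (t : ℝ) :
    ∫ U, sinCoeff t (x₀ U) ^ 2 * x₁ U ^ 2 ∂haarSU 2 = (1 - blochZ t) / 4 := by
  have h := three_mul_integral_sinCoeff_sq t
  have hc := Real.continuous_arccos
  rw [integral_comp_x₀ (h := fun x => Real.sin (t * Real.arccos x) ^ 2) (by fun_prop)] at h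
  have e : ∫ θ in 0..Real.pi, Real.sin (t * Real.arccos (Real.cos θ)) ^ 2 * Real.sin θ ^ 2 =
      ∫ θ in 0..Real.pi, Real.sin (t * θ) ^ 2 * Real.sin θ ^ 2 :=
    intervalIntegral.integral_congr fun θ hθ => by
      rw [Set.uIcc_of_le Real.pi_pos.le] at hθ
      simp only [Real.arccos_cos hθ.1 hθ.2]
  rw [e] at h
  rw [blochZ]
  linear_combination h / 3

theorem integral_cosCoeff_sq_add (t : ℝ) :
    ∫ U, (cosCoeff t (x₀ U) ^ 2 + sinCoeff t (x₀ U) ^ 2 * x₁ U ^ 2) ∂haarSU 2 =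
      (1 + blochZ t) / 2 := by
  have hc := Real.continuous_arccos
  have e : ∫ U, cosCoeff t (x₀ U) ^ 2 ∂haarSU 2 =
      1 - ∫ U, Real.sin (t * Real.arccos (x₀ U)) ^ 2 ∂haarSU 2 := by
    rw [eq_sub_iff_add_eq, ← integral_add (integrable_haarSU_of_continuous (by fun_prop))
      (integrable_haarSU_of_continuous (by fun_prop))]
    simp [cosCoeff]
  rw [integral_add (integrable_haarSU_of_continuous (by fun_prop))
    (integrable_sinCoeff_sq_mul t continuous_x₁ x₁_sq_le), e, ← three_mul_integral_sinCoeff_sq,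
    integral_sinCoeff_sq]
  ring

theorem integral_sinCoeff_sq_add (t : ℝ) :
    ∫ U, (sinCoeff t (x₀ U) ^ 2 * x₂ U ^ 2 + sinCoeff t (x₀ U) ^ 2 * x₃ U ^ 2) ∂haarSU 2 =
      (1 - blochZ t) / 2 := by
  have h2 := integral_x₁_sq_eq_x₂_sq (fun x => sinCoeff t x ^ 2)
  have h3 := integral_x₂_sq_eq_x₃_sq (fun x => sinCoeff t x ^ 2)
  rw [integral_add (integrable_sinCoeff_sq_mul t continuous_x₂ x₂_sq_le)
    (integrable_sinCoeff_sq_mul t continuous_x₃ x₃_sq_le), ← h3, ← h2, integral_sinCoeff_sq]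
  ring

theorem ae_historyEvolution_apply (t : ℝ) (i j : Fin 2) :
    (fun U => historyEvolution ((1 / 2 : ℂ) • (1 + pauliZ)) t U i j) =ᵐ[haarSU 2] fun U =>
      !![((cosCoeff t (x₀ U) ^ 2 + sinCoeff t (x₀ U) ^ 2 * x₁ U ^ 2 : ℝ) : ℂ),
        star (offDiag t (x₀ U) (x₁ U) (x₂ U) (x₃ U));
        offDiag t (x₀ U) (x₁ U) (x₂ U) (x₃ U),
        ((sinCoeff t (x₀ U) ^ 2 * x₂ U ^ 2 + sinCoeff t (x₀ U) ^ 2 * x₃ U ^ 2 : ℝ) : ℂ)] i j := by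
  filter_upwards [ae_neg_one_lt_x₀] with U hU
  rw [historyEvolution_eq hU]

theorem integrable_historyEvolution (t : ℝ) (i j : Fin 2) :
    Integrable (fun U : SU 2 => historyEvolution ((1 / 2 : ℂ) • (1 + pauliZ)) t U i j)
      (haarSU 2) := by
  rw [integrable_congr (ae_historyEvolution_apply t i j)]
  fin_cases i <;> fin_cases j
  · exact ((integrable_haarSU_of_continuous (by fun_prop)).add
      (integrable_sinCoeff_sq_mul t continuous_x₁ x₁_sq_le)).ofReal
  · exact Complex.conjCLE.toContinuousLinearMap.integrable_comp (integrable_offDiag t)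
  · exact integrable_offDiag t
  · exact ((integrable_sinCoeff_sq_mul t continuous_x₂ x₂_sq_le).add
      (integrable_sinCoeff_sq_mul t continuous_x₃ x₃_sq_le)).ofReal

theorem haarEvolution_eq (t : ℝ) :
    haarEvolution ((1 / 2 : ℂ) • (1 + pauliZ)) t =
      (1 / 2 : ℂ) • (1 + (blochZ t : ℂ) • pauliZ) := by
  ext i j
  rw [haarEvolution, Matrix.of_apply, integral_congr_ae (ae_historyEvolution_apply t i j)]
  fin_cases i <;> fin_cases j
  · refine (integral_ofReal.trans (congrArg _ (integral_cosCoeff_sq_add t))).trans ?_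
    simp [pauliZ]; ring
  · refine integral_conj.trans ?_
    rw [integral_offDiag]
    simp [pauliZ]
  · refine (integral_offDiag t).trans ?_
    simp [pauliZ]
  · refine (integral_ofReal.trans (congrArg _ (integral_sinCoeff_sq_add t))).trans ?_
    simp [pauliZ]; ring

/-! ### Continuity, special values and the closed form -/

theorem continuous_blochZ : Continuous blochZ := by
  unfold blochZ
  refine continuous_const.sub (continuous_const.mul ?_)
  exact intervalIntegral.continuous_parametric_intervalIntegral_of_continuous' (by fun_prop) _ _

theorem blochZ_zero : blochZ 0 = 1 := by simp [blochZ]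

theorem blochZ_one : blochZ 1 = 0 := by
  have h := integral_sin_pow_even 2
  have e : ∀ θ : ℝ, Real.sin (1 * θ) ^ 2 * Real.sin θ ^ 2 = Real.sin θ ^ (2 * 2) := fun θ => by
    ring_nf
  rw [blochZ]
  simp only [e, h, Finset.prod_range_succ]
  have := Real.pi_ne_zero
  simp
  field_simp
  norm_num

theorem blochZ_eq {t : ℝ} (ht : t - t ^ 3 ≠ 0) :
    blochZ t = 1 / 3 + Real.sin (2 * Real.pi * t) / (3 * Real.pi * (t - t ^ 3)) := by
  have hf : t - t ^ 3 = t * ((1 - t) * (1 + t)) := by ring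
  rw [hf] at ht
  have h0 : t ≠ 0 := left_ne_zero_of_mul ht
  have h1 : 1 - t ≠ 0 := left_ne_zero_of_mul (right_ne_zero_of_mul ht)
  have h2 : 1 + t ≠ 0 := right_ne_zero_of_mul (right_ne_zero_of_mul ht)
  have hs : ∀ c θ : ℝ, c ≠ 0 →
      HasDerivAt (fun θ => Real.sin (2 * c * θ) / (2 * c)) (Real.cos (2 * c * θ)) θ :=
    fun c θ hc => by
      have := (((hasDerivAt_id θ).const_mul (2 * c)).sin.div_const (2 * c))
      refine this.congr_deriv ?_
      simp
      field_simp
  -- Product-to-sum: sin² tθ sin² θ = (1 − cos 2tθ − cos 2θ + (cos 2(1+t)θ + cos 2(1−t)θ)/2)/4. The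
  -- excluded values 0, ±1 of t are those at which a frequency vanishes.
  have h := intervalIntegral.integral_eq_sub_of_hasDerivAt (a := 0) (b := Real.pi)
    (f := fun θ => (θ - Real.sin (2 * t * θ) / (2 * t) - Real.sin (2 * 1 * θ) / (2 * 1) +
      (Real.sin (2 * (1 + t) * θ) / (2 * (1 + t)) +
        Real.sin (2 * (1 - t) * θ) / (2 * (1 - t))) / 2) / 4)
    (f' := fun θ => Real.sin (t * θ) ^ 2 * Real.sin θ ^ 2) (fun θ _ => by
      refine (((((hasDerivAt_id θ).sub (hs t θ h0)).sub (hs 1 θ one_ne_zero)).add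
        (((hs (1 + t) θ h2).add (hs (1 - t) θ h1)).div_const 2)).div_const 4).congr_deriv ?_
      rw [show 2 * (1 + t) * θ = 2 * (θ + t * θ) by ring,
        show 2 * (1 - t) * θ = 2 * (θ - t * θ) by ring, show 2 * t * θ = 2 * (t * θ) by ring,
        show 2 * 1 * θ = 2 * θ by ring, mul_add, mul_sub, Real.cos_add, Real.cos_sub,
        Real.sin_sq_eq_half_sub, Real.sin_sq_eq_half_sub]
      ring)
    (Continuous.intervalIntegrable (by fun_prop) _ _)
  have p1 : Real.sin (2 * (1 + t) * Real.pi) = Real.sin (2 * Real.pi * t) := by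
    rw [← Real.sin_add_two_pi (2 * Real.pi * t)]; ring_nf
  have p2 : Real.sin (2 * (1 - t) * Real.pi) = -Real.sin (2 * Real.pi * t) := by
    rw [← Real.sin_two_pi_sub]; ring_nf
  have p3 : Real.sin (2 * 1 * Real.pi) = 0 := by rw [mul_one, Real.sin_two_pi]
  have p4 : Real.sin (2 * t * Real.pi) = Real.sin (2 * Real.pi * t) := by ring_nf
  -- The integral equals π/4 − sin(2πt)/(8(t − t³)), by partial fractions in t.
  rw [blochZ, h, p1, p2, p3, p4, hf]
  simp only [mul_zero, Real.sin_zero, zero_div]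
  have hpi := Real.pi_ne_zero
  field_simp
  ring

end SU2

theorem mainTheorem5 :
    ∃ nz : ℝ → ℝ,
      (∀ t : ℝ,
        (∀ i j : Fin 2,
          Integrable (fun U : SU 2 => historyEvolution ((1 / 2 : ℂ) • (1 + pauliZ)) t U i j)
            (haarSU 2)) ∧
        haarEvolution ((1 / 2 : ℂ) • (1 + pauliZ)) t =
          (1 / 2 : ℂ) • (1 + (nz t : ℂ) • pauliZ)) ∧
      (∀ t : ℝ, t - t ^ 3 ≠ 0 →
        nz t = 1 / 3 + Real.sin (2 * Real.pi * t) / (3 * Real.pi * (t - t ^ 3))) ∧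
      Continuous nz ∧ nz 0 = 1 ∧ nz 1 = 0 :=
  ⟨SU2.blochZ, fun t => ⟨SU2.integrable_historyEvolution t, SU2.haarEvolution_eq t⟩,
    fun _ ht => SU2.blochZ_eq ht, SU2.continuous_blochZ, SU2.blochZ_zero, SU2.blochZ_one⟩
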